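/- Let $X\subset\mathbb R^n$ be nonempty, closed and convex, let $g_0,g_1:\mathbb R^n\to\mathbb R$ be continuously differentiable with locally Lipschitzian gradients on $X$, and let $h_0,h_1:\mathbb R^n\to(-\infty,\infty]$ be, at every point of $X$, Lipschitz continuous around this point and prox-regular. Put $\varphi_i:=g_i-h_i$ for $i=0,1$, assume that $\varphi_0$ is bounded from below on $X$, and consider the problem of minimizing $\varphi_0(x)$ over $x\in X$ subject to $\varphi_1(x)\le 0$. For $p>0$ let $\phi_p(x):=\frac1p\varphi_0(x)+\max\{\varphi_1(x),0\}$. Denote by $\partial h$ the limiting (Mordukhovich) subdifferential and by $\mathcal N_X$ the normal cone to the convex set $X$. The algorithm CDP-ESQM has the parameters $\beta,\sigma\in(0,1)$ and $\alpha,p_0,\varrho_p,c_p>0$ and starts at a point $x^0\in X$. At iteration $k=0,1,\dots$ it takes $v_i^k\in\partial h_i(x^k)$, $i=0,1$, and lets $d^k$ be the solution of $$\min_{d\in\mathbb R^n,\;x^k+d\in X}\ \frac1{p_k}\big(\varphi_0(x^k)+\langle\nabla g_0(x^k)-v_0^k,d\rangle\big)+\max\big\{\varphi_1(x^k)+\langle\nabla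 g_1(x^k)-v_1^k,d\rangle,0\big\}+\frac\alpha2\|d\|^2 .$$ It terminates if $d^k=0$ and $\varphi_1(x^k)\le0$. Otherwise it puts $x^{k+1}:=x^k+\tau_kd^k$, where $\tau_k=\beta^{q_k}$ and $q_k$ is the smallest nonnegative integer with $\phi_{p_k}(x^k+\tau_kd^k)\le\phi_{p_k}(x^k)-\sigma\tau_k\alpha\|d^k\|^2$, and it puts $p_{k+1}:=p_k+\varrho_p$ if $t^k:=\max\{\varphi_1(x^k)+\langle\nabla g_1(x^k)-v_1^k,d^k\rangle,0\}\ge c_p\|d^k\|$ and $p_{k+1}:=p_k$ otherwise. The extended no nonzero abnormal multiplier constraint qualification (ENNAMCQ) holds at $\bar x\in X$ if either $\varphi_1(\bar x)<0$, or $\varphi_1(\bar x)\ge0$ and $0\notin\nabla g_1(\bar x)-\partial h_1(\bar x)+\mathcal N_X(\bar x)$. Proposition. Suppose that CDP-ESQM does not terminate, let $\{x^k\}$ and $\{p_k\}$ be the sequences generated by it, and assume that $\{x^k\}$ is bounded. If ENNAMCQ holds at every accumulation point of $\{x^k\}$, then the sequence of penalty parameters $\{p_k\}$ is bounded. -/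

import Mathlib

open Filter Topology
open scoped NNReal Pointwise InnerProductSpace

noncomputable section

namespace CDP

/-- The Euclidean space of dimension `n`. -/
abbrev Eucl (n : ℕ) : Type := EuclideanSpace ℝ (Fin n)

/-! ### Variational analysis for functions with values in `(-∞, ∞]`

Extended-real-valued functions are modelled as functions into `EReal`; that the value `⊥` is not
taken is imposed in `Problem.Standing` below. -/

section VariationalAnalysis

variable {n : ℕ}

/-- The (Fréchet) regular subdifferential of `f` at `x` (empty outside the domain of `f`). -/
def regularSubdiff (f : Eucl n → EReal) (x : Eucl n) : Set (Eucl n) :=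
  {v | f x ≠ ⊤ ∧
    0 ≤ liminf (fun u : Eucl n =>
      (f u - f x - ((⟪v, u - x⟫_ℝ : ℝ) : EReal)) / ((‖u - x‖ : ℝ) : EReal)) (𝓝[≠] x)}

/-- The (Mordukhovich) limiting subdifferential of `f` at `x` (empty outside the domain of `f`). -/
def limitingSubdiff (f : Eucl n → EReal) (x : Eucl n) : Set (Eucl n) :=
  {v | f x ≠ ⊤ ∧ ∃ (y w : ℕ → Eucl n),
    Tendsto y atTop (𝓝 x) ∧ Tendsto (fun k => f (y k)) atTop (𝓝 (f x)) ∧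
    (∀ k, w k ∈ regularSubdiff f (y k)) ∧ Tendsto w atTop (𝓝 v)}

/-- `f` is prox-regular at `x₀` for `v₀`. -/
def ProxRegularAtFor (f : Eucl n → EReal) (x₀ v₀ : Eucl n) : Prop :=
  (∀ᶠ x in 𝓝 x₀, LowerSemicontinuousAt f x) ∧
  ∃ ε : ℝ, 0 < ε ∧ ∃ r : ℝ, 0 ≤ r ∧
    ∀ x ∈ Metric.closedBall x₀ ε, ∀ x' ∈ Metric.closedBall x₀ ε,
      f x ≤ f x₀ + (ε : EReal) →
      ∀ v ∈ limitingSubdiff f x ∩ Metric.closedBall v₀ ε,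
        f x + ((⟪v, x' - x⟫_ℝ - r / 2 * ‖x' - x‖ ^ 2 : ℝ) : EReal) ≤ f x'

/-- `f` is prox-regular at the point `x₀` of its domain: it is so for every limiting subgradient. -/
def ProxRegularAt (f : Eucl n → EReal) (x₀ : Eucl n) : Prop :=
  f x₀ ≠ ⊤ ∧ ∀ v₀ ∈ limitingSubdiff f x₀, ProxRegularAtFor f x₀ v₀

/-- `f` is finite and Lipschitz continuous on a neighbourhood of `x₀`. -/
def LocallyLipschitzAround (f : Eucl n → EReal) (x₀ : Eucl n) : Prop :=
  ∃ U ∈ 𝓝 x₀, (∀ y ∈ U, f y ≠ ⊤ ∧ f y ≠ ⊥) ∧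
    ∃ K : ℝ≥0, LipschitzOnWith K (fun y => (f y).toReal) U

/-- `g` is continuously differentiable with locally Lipschitzian gradient on `X`
(only points of `X` are involved; this follows if `g` is of class `C^{1,1}` around `X`). -/
def IsC11On (g : Eucl n → ℝ) (X : Set (Eucl n)) : Prop :=
  (∀ x ∈ X, DifferentiableAt ℝ g x) ∧ LocallyLipschitzOn X (gradient g)

/-- The normal cone of convex analysis, empty at points outside `D`. -/
def normalCone (D : Set (Eucl n)) (x : Eucl n) : Set (Eucl n) :=
  {v | x ∈ D ∧ ∀ x' ∈ D, ⟪v, x' - x⟫_ℝ ≤ 0}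

end VariationalAnalysis

/-- The data of the constrained difference program:
minimize `g₀ - h₀` over `X` subject to `g₁ - h₁ ≤ 0`. -/
structure Problem (n : ℕ) where
  X : Set (Eucl n)
  g₀ : Eucl n → ℝ
  g₁ : Eucl n → ℝ
  h₀ : Eucl n → EReal
  h₁ : Eucl n → EReal

namespace Problem

variable {n : ℕ} (P : Problem n)

/-- The objective `φ₀ = g₀ - h₀`. Under `Standing` the function `h₀` is finite on `X`, and `φ₀` is
only used there. -/
def φ₀ (x : Eucl n) : ℝ := P.g₀ x - (P.h₀ x).toReal

/-- The constraint function `φ₁ = g₁ - h₁`; the same remark applies. -/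
def φ₁ (x : Eucl n) : ℝ := P.g₁ x - (P.h₁ x).toReal

/-- The standing assumptions on the data of the problem. -/
structure Standing : Prop where
  nonempty : P.X.Nonempty
  closed : IsClosed P.X
  convex : Convex ℝ P.X
  g₀_c11 : IsC11On P.g₀ P.X
  g₁_c11 : IsC11On P.g₁ P.X
  h₀_ne_bot : ∀ x, P.h₀ x ≠ ⊥
  h₁_ne_bot : ∀ x, P.h₁ x ≠ ⊥
  h₀_lip : ∀ x ∈ P.X, LocallyLipschitzAround P.h₀ x
  h₁_lip : ∀ x ∈ P.X, LocallyLipschitzAround P.h₁ x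
  h₀_prox : ∀ x ∈ P.X, ProxRegularAt P.h₀ x
  h₁_prox : ∀ x ∈ P.X, ProxRegularAt P.h₁ x
  φ₀_bddBelow : BddBelow (P.φ₀ '' P.X)

/-- The extended no nonzero abnormal multiplier constraint qualification at `x`. -/
def ENNAMCQ (x : Eucl n) : Prop :=
  x ∈ P.X ∧ (P.φ₁ x < 0 ∨
    (0 ≤ P.φ₁ x ∧
      (0 : Eucl n) ∉ {gradient P.g₁ x} - limitingSubdiff P.h₁ x + normalCone P.X x))

/-- The objective of the penalized problem with penalty parameter `p`. -/
def penalized (p : ℝ) (x : Eucl n) : ℝ := 1 / p * P.φ₀ x + max (P.φ₁ x) 0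

/-- The linear approximation at `x` (evaluated at `y`) of the penalized objective, built with the
subgradients `v₀`, `v₁` of `h₀`, `h₁` at `x`. -/
def linearized (p : ℝ) (x v₀ v₁ y : Eucl n) : ℝ :=
  1 / p * (P.φ₀ x + ⟪gradient P.g₀ x - v₀, y - x⟫_ℝ) +
    max (P.φ₁ x + ⟪gradient P.g₁ x - v₁, y - x⟫_ℝ) 0

/-- `d` solves the direction subproblem: minimize
`linearized (x + d) + α / 2 * ‖d‖ ^ 2` over all `d` with `x + d ∈ X`. -/
def SolvesSubproblem (α p : ℝ) (x v₀ v₁ d : Eucl n) : Prop :=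
  x + d ∈ P.X ∧
  IsMinOn (fun e => P.linearized p x v₀ v₁ (x + e) + α / 2 * ‖e‖ ^ 2) {e | x + e ∈ P.X} d

/-- The approximate constraint violation `t`. -/
def violation (x v₁ d : Eucl n) : ℝ :=
  max (P.φ₁ x + ⟪gradient P.g₁ x - v₁, d⟫_ℝ) 0

/-- The sufficient decrease condition for the stepsize `τ`. -/
def SufficientDecrease (σ α p : ℝ) (x d : Eucl n) (τ : ℝ) : Prop :=
  P.penalized p (x + τ • d) ≤ P.penalized p x - σ * τ * α * ‖d‖ ^ 2

end Problem

/-- The input parameters of the algorithm CDP-ESQM: `β` and `σ` for the linesearch, the proximal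
parameter `α`, and `p₀`, `ρ`, `c` for the penalty parameter. -/
structure Params where
  β : ℝ
  σ : ℝ
  α : ℝ
  p₀ : ℝ
  ρ : ℝ
  c : ℝ

/-- The ranges prescribed for the input parameters. -/
structure Params.Admissible (A : Params) : Prop where
  β_pos : 0 < A.β
  β_lt_one : A.β < 1
  σ_pos : 0 < A.σ
  σ_lt_one : A.σ < 1
  α_pos : 0 < A.α
  p₀_pos : 0 < A.p₀
  ρ_pos : 0 < A.ρ
  c_pos : 0 < A.c

/-- The sequences produced by CDP-ESQM: iterates `x`, chosen subgradients `v₀`, `v₁`,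
directions `d`, backtracking exponents `q` (the stepsize is `β ^ q k`), penalty parameters `p`. -/
structure Trace (n : ℕ) where
  x : ℕ → Eucl n
  v₀ : ℕ → Eucl n
  v₁ : ℕ → Eucl n
  d : ℕ → Eucl n
  q : ℕ → ℕ
  p : ℕ → ℝ

open Classical in
/-- `T` follows the rules of CDP-ESQM at every iteration. The stopping test is separate, see
`StopsAt`. -/
structure Trace.Generated {n : ℕ} (T : Trace n) (P : Problem n) (A : Params) : Prop where
  x_zero : T.x 0 ∈ P.X
  p_zero : T.p 0 = A.p₀
  v₀_mem : ∀ k, T.v₀ k ∈ limitingSubdiff P.h₀ (T.x k)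
  v₁_mem : ∀ k, T.v₁ k ∈ limitingSubdiff P.h₁ (T.x k)
  d_solves : ∀ k, P.SolvesSubproblem A.α (T.p k) (T.x k) (T.v₀ k) (T.v₁ k) (T.d k)
  linesearch : ∀ k,
    IsLeast {j : ℕ | P.SufficientDecrease A.σ A.α (T.p k) (T.x k) (T.d k) (A.β ^ j)} (T.q k)
  x_succ : ∀ k, T.x (k + 1) = T.x k + A.β ^ T.q k • T.d k
  p_succ : ∀ k, T.p (k + 1) =
    if A.c * ‖T.d k‖ ≤ P.violation (T.x k) (T.v₁ k) (T.d k) then T.p k + A.ρ else T.p k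

/-- The stopping test of CDP-ESQM is met at iteration `k`. -/
def Trace.StopsAt {n : ℕ} (T : Trace n) (P : Problem n) (k : ℕ) : Prop :=
  T.d k = 0 ∧ P.φ₁ (T.x k) ≤ 0

end CDP

end

namespace CDP

variable {n : ℕ}

/-! If the penalty parameters were unbounded, then, being nondecreasing, they would tend to
infinity, and the test that raises them would succeed infinitely often (`frequently_violation`).
Along an ultrafilter containing those indices, iterates, subgradients and directions all converge,
since they are bounded there.

The directions tend to zero (`limit_direction_eq_zero`). Otherwise summing the linesearch decreases
forces the stepsizes to zero, so trial steps tending to zero are rejected. But prox-regularity of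
`h` near the limiting subgradient, with the Lipschitz gradient of `g`, gives a uniform quadratic
upper model of `g - h`, which makes short steps acceptable.

At these indices the linearized constraint is positive, so the maximum in the subproblem is smooth
near its solution. In the resulting variational inequality (`SolvesSubproblem.variational`) the
objective has weight `1 / p`, tending to zero. In the limit only the constraint term and the normal
cone remain, at a point with `0 ≤ φ₁`. This contradicts ENNAMCQ. -/

lemma LocallyLipschitzAround.continuousAt_toReal {f : Eucl n → EReal} {x : Eucl n}
    (hf : LocallyLipschitzAround f x) : ContinuousAt (fun y => (f y).toReal) x := by
  obtain ⟨U, hU, -, K, hK⟩ := hf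
  exact hK.continuousOn.continuousAt hU

lemma LocallyLipschitzAround.continuousAt {f : Eucl n → EReal} {x : Eucl n}
    (hf : LocallyLipschitzAround f x) : ContinuousAt f x := by
  have h1 : ContinuousAt (fun y => ((f y).toReal : EReal)) x :=
    continuous_coe_real_ereal.continuousAt.comp hf.continuousAt_toReal
  obtain ⟨U, hU, hfin, -⟩ := hf
  refine h1.congr ?_
  filter_upwards [hU] with y hy
  exact EReal.coe_toReal (hfin y hy).1 (hfin y hy).2

/-- Testing the subgradient inequality along the ray `x + t • v` bounds `‖v‖` by the Lipschitz
difference quotient, up to `ε`. -/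
lemma norm_le_of_mem_regularSubdiff {f : Eucl n → EReal} {x v : Eucl n} {U : Set (Eucl n)}
    (hU : U ∈ 𝓝 x) (hfin : ∀ y ∈ U, f y ≠ ⊤ ∧ f y ≠ ⊥) {K : ℝ≥0}
    (hK : LipschitzOnWith K (fun y => (f y).toReal) U) (hv : v ∈ regularSubdiff f x) :
    ‖v‖ ≤ K := by
  rcases eq_or_ne v 0 with rfl | hv0
  · simp
  have hvpos : 0 < ‖v‖ := norm_pos_iff.2 hv0
  refine le_of_forall_pos_le_add fun ε hε => ?_
  have hlim := hv.2
  have hev : ∀ᶠ u in 𝓝[≠] x, ((-ε : ℝ) : EReal) <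
      (f u - f x - ((⟪v, u - x⟫_ℝ : ℝ) : EReal)) / ((‖u - x‖ : ℝ) : EReal) := by
    refine eventually_lt_of_lt_liminf (lt_of_lt_of_le ?_ hlim)
    exact_mod_cast neg_lt_zero.2 hε
  have hline : Tendsto (fun t : ℝ => x + t • v) (𝓝[>] 0) (𝓝[≠] x) := by
    refine tendsto_nhdsWithin_iff.2 ⟨?_, ?_⟩
    · have : Continuous fun t : ℝ => x + t • v := by fun_prop
      simpa using (this.tendsto 0).mono_left nhdsWithin_le_nhds
    · filter_upwards [self_mem_nhdsWithin] with t ht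
      simp [hv0, (Set.mem_Ioi.1 ht).ne']
  have hevU : ∀ᶠ u in 𝓝[≠] x, u ∈ U := mem_nhdsWithin_of_mem_nhds hU
  obtain ⟨t, ⟨h1, h2⟩, ht⟩ :=
    ((hline.eventually (hev.and hevU)).and self_mem_nhdsWithin).exists
  have ht : 0 < t := ht
  have hxU := mem_of_mem_nhds hU
  have hlip := hK.dist_le_mul _ h2 _ hxU
  rw [← EReal.coe_toReal (hfin _ h2).1 (hfin _ h2).2,
    ← EReal.coe_toReal (hfin _ hxU).1 (hfin _ hxU).2] at h1
  norm_cast at h1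
  rw [← EReal.coe_div, EReal.coe_lt_coe_iff] at h1
  simp only [add_sub_cancel_left, inner_smul_right, real_inner_self_eq_norm_sq, norm_smul,
    Real.norm_eq_abs, abs_of_pos ht, dist_eq_norm] at h1 hlip
  rw [lt_div_iff₀ (by positivity)] at h1
  have h3 := (le_abs_self _).trans hlip
  have h4 : t * ‖v‖ * ‖v‖ ≤ t * ‖v‖ * (K + ε) := by nlinarith
  exact le_of_mul_le_mul_left h4 (by positivity)

/-- Working with the closure of the regular graph avoids a diagonal sequence in the closed-graph
argument. -/
lemma mem_closure_of_mem_limitingSubdiff {f : Eucl n → EReal} {x v : Eucl n}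
    (hv : v ∈ limitingSubdiff f x) :
    (x, v) ∈ closure {z : Eucl n × Eucl n | z.2 ∈ regularSubdiff f z.1} := by
  obtain ⟨-, y, w, hy, -, hw, hwv⟩ := hv
  exact mem_closure_of_tendsto (hy.prodMk_nhds hwv) (Eventually.of_forall hw)

/-- Limiting subgradients of a locally Lipschitz function are bounded near the point. -/
lemma LocallyLipschitzAround.exists_norm_le {f : Eucl n → EReal} {x : Eucl n}
    (hf : LocallyLipschitzAround f x) :
    ∃ K : ℝ, ∀ᶠ y in 𝓝 x, ∀ v ∈ limitingSubdiff f y, ‖v‖ ≤ K := by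
  obtain ⟨U, hU, hfin, K, hK⟩ := hf
  refine ⟨K, ?_⟩
  filter_upwards [eventually_mem_nhds_iff.2 hU] with y hy v hv
  obtain ⟨-, z, w, hz, -, hw, hwv⟩ := hv
  refine le_of_tendsto hwv.norm ?_
  filter_upwards [hz.eventually (eventually_mem_nhds_iff.2 hy)] with k hk
  exact norm_le_of_mem_regularSubdiff hk hfin hK (hw k)

/-- The limiting subdifferential of a locally Lipschitz function has closed graph. -/
lemma LocallyLipschitzAround.mem_limitingSubdiff_of_tendsto {f : Eucl n → EReal} {x v : Eucl n}
    (hf : LocallyLipschitzAround f x) {ι : Type*} {l : Filter ι} [l.NeBot] {y w : ι → Eucl n}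
    (hy : Tendsto y l (𝓝 x)) (hw : Tendsto w l (𝓝 v))
    (hmem : ∀ i, w i ∈ limitingSubdiff f (y i)) : v ∈ limitingSubdiff f x := by
  have hcl : (x, v) ∈ closure {z : Eucl n × Eucl n | z.2 ∈ regularSubdiff f z.1} :=
    isClosed_closure.mem_of_tendsto (hy.prodMk_nhds hw)
      (Eventually.of_forall fun i => mem_closure_of_mem_limitingSubdiff (hmem i))
  obtain ⟨z, hz, hzlim⟩ := mem_closure_iff_seq_limit.1 hcl
  obtain ⟨h1, h2⟩ := Prod.tendsto_iff _ _ |>.1 hzlim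
  have hfx : f x ≠ ⊤ := by
    obtain ⟨U, hU, hfin, -⟩ := hf
    exact (hfin x (mem_of_mem_nhds hU)).1
  exact ⟨hfx, fun k => (z k).1, fun k => (z k).2, h1, hf.continuousAt.tendsto.comp h1, hz, h2⟩

/-- Prox-regularity of a locally Lipschitz function yields a uniform quadratic lower model. -/
lemma ProxRegularAt.exists_lower_model {f : Eucl n → EReal} {x₀ v₀ : Eucl n}
    (hf : ProxRegularAt f x₀) (hlip : LocallyLipschitzAround f x₀)
    (hv₀ : v₀ ∈ limitingSubdiff f x₀) :
    ∃ r : ℝ, 0 ≤ r ∧ ∃ δ : ℝ, 0 < δ ∧ ∀ x ∈ Metric.ball x₀ δ, ∀ x' ∈ Metric.ball x₀ δ,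
      ∀ v ∈ limitingSubdiff f x, v ∈ Metric.ball v₀ δ →
        (f x).toReal + ⟪v, x' - x⟫_ℝ - r / 2 * ‖x' - x‖ ^ 2 ≤ (f x').toReal := by
  have hcont := hlip.continuousAt_toReal
  obtain ⟨U, hU, hfin, -⟩ := hlip
  obtain ⟨-, ε, hε, r, hr, hmodel⟩ := hf.2 v₀ hv₀
  -- Prox-regularity only concerns points with values close to `f x₀`; continuity makes this
  -- automatic nearby.
  have hev : ∀ᶠ x in 𝓝 x₀, x ∈ U ∧ (f x).toReal < (f x₀).toReal + ε :=
    (show ∀ᶠ x in 𝓝 x₀, x ∈ U from hU).and (hcont.eventually_lt_const (by simpa using hε))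
  obtain ⟨η, hη, hball⟩ := Metric.eventually_nhds_iff_ball.1 hev
  refine ⟨r, hr, min η ε, lt_min hη hε, fun x hx x' hx' v hv hvb => ?_⟩
  have sub1 : Metric.ball x₀ (min η ε) ⊆ Metric.ball x₀ η :=
    Metric.ball_subset_ball (min_le_left _ _)
  have sub2 : ∀ z : Eucl n, Metric.ball z (min η ε) ⊆ Metric.closedBall z ε := fun z =>
    (Metric.ball_subset_ball (min_le_right _ _)).trans Metric.ball_subset_closedBall
  have hx0 := hfin x₀ (mem_of_mem_nhds hU)
  have hxU := hball x (sub1 hx)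
  have hxU' := hball x' (sub1 hx')
  have hxf := hfin x hxU.1
  have hxf' := hfin x' hxU'.1
  have key := hmodel x (sub2 _ hx) x' (sub2 _ hx')
  rw [← EReal.coe_toReal hx0.1 hx0.2, ← EReal.coe_toReal hxf.1 hxf.2,
    ← EReal.coe_toReal hxf'.1 hxf'.2] at key
  norm_cast at key
  have := key hxU.2.le v ⟨hv, sub2 _ hvb⟩
  linarith

/-- A quadratic upper model for a function with locally Lipschitz gradient on a convex set. -/
lemma IsC11On.exists_upper_model {g : Eucl n → ℝ} {X : Set (Eucl n)} (hg : IsC11On g X)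
    (hX : Convex ℝ X) {x₀ : Eucl n} (hx₀ : x₀ ∈ X) :
    ∃ L : ℝ, 0 ≤ L ∧ ∃ δ : ℝ, 0 < δ ∧ ∀ x ∈ X ∩ Metric.ball x₀ δ, ∀ x' ∈ X ∩ Metric.ball x₀ δ,
      g x' ≤ g x + ⟪gradient g x, x' - x⟫_ℝ + L * ‖x' - x‖ ^ 2 := by
  obtain ⟨L, t, ht, hL⟩ := hg.2 hx₀
  obtain ⟨δ, hδ, hsub⟩ := Metric.mem_nhdsWithin_iff.1 ht
  refine ⟨L, L.2, δ, hδ, fun x hx x' hx' => ?_⟩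
  have hseg : segment ℝ x x' ⊆ X ∩ Metric.ball x₀ δ :=
    (hX.inter (convex_ball x₀ δ)).segment_subset hx hx'
  have hmt : ∀ z ∈ X ∩ Metric.ball x₀ δ, z ∈ t := fun z hz => hsub ⟨hz.2, hz.1⟩
  -- Mean value inequality for `g` minus its linearization at `x`; the cruder constant `L` instead
  -- of `L / 2` suffices.
  have key := (convex_segment x x').norm_image_sub_le_of_norm_hasFDerivWithin_le'
    (f := g) (f' := fun z => InnerProductSpace.toDual ℝ (Eucl n) (gradient g z))
    (φ := InnerProductSpace.toDual ℝ (Eucl n) (gradient g x)) (C := L * ‖x' - x‖)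
    (fun z hz => (hg.1 z (hseg hz).1).hasGradientAt.hasFDerivAt.hasFDerivWithinAt)
    (fun z hz => by
      rw [← map_sub, LinearIsometryEquiv.norm_map, ← dist_eq_norm]
      refine (hL.dist_le_mul _ (hmt z (hseg hz)) _ (hmt x hx)).trans ?_
      gcongr
      rw [dist_eq_norm]
      obtain ⟨θ, hθ, rfl⟩ := (segment_eq_image' ℝ x x') ▸ hz
      simp only [add_sub_cancel_left, norm_smul, Real.norm_eq_abs, abs_of_nonneg hθ.1]
      exact mul_le_of_le_one_left (norm_nonneg _) hθ.2)
    (left_mem_segment ℝ x x') (right_mem_segment ℝ x x')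
  rw [InnerProductSpace.toDual_apply_apply] at key
  have := (le_abs_self _).trans key
  linarith

/-- A quadratic upper model for the difference of a function with locally Lipschitz gradient and a
prox-regular one. -/
lemma exists_upper_model_sub {g : Eucl n → ℝ} {h : Eucl n → EReal} {X : Set (Eucl n)}
    (hg : IsC11On g X) (hX : Convex ℝ X) {x₀ v₀ : Eucl n} (hx₀ : x₀ ∈ X)
    (hprox : ProxRegularAt h x₀) (hlip : LocallyLipschitzAround h x₀)
    (hv₀ : v₀ ∈ limitingSubdiff h x₀) :
    ∃ C : ℝ, 0 ≤ C ∧ ∃ δ : ℝ, 0 < δ ∧ ∀ x ∈ X ∩ Metric.ball x₀ δ, ∀ x' ∈ X ∩ Metric.ball x₀ δ,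
      ∀ v ∈ limitingSubdiff h x, v ∈ Metric.ball v₀ δ →
        g x' - (h x').toReal ≤
          g x - (h x).toReal + ⟪gradient g x - v, x' - x⟫_ℝ + C * ‖x' - x‖ ^ 2 := by
  obtain ⟨r, hr, δ, hδ, hlow⟩ := hprox.exists_lower_model hlip hv₀
  obtain ⟨L, hL, η, hη, hup⟩ := hg.exists_upper_model hX hx₀
  refine ⟨L + r / 2, by positivity, min δ η, lt_min hδ hη, fun x hx x' hx' v hv hvb => ?_⟩
  have sub1 : ∀ z : Eucl n, Metric.ball z (min δ η) ⊆ Metric.ball z δ := fun z =>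
    Metric.ball_subset_ball (min_le_left _ _)
  have sub2 : Metric.ball x₀ (min δ η) ⊆ Metric.ball x₀ η :=
    Metric.ball_subset_ball (min_le_right _ _)
  have h1 := hlow x (sub1 _ hx.2) x' (sub1 _ hx'.2) v hv (sub1 _ hvb)
  have h2 := hup x ⟨hx.1, sub2 hx.2⟩ x' ⟨hx'.1, sub2 hx'.2⟩
  rw [inner_sub_left]
  linarith

/-! ### The direction subproblem -/

namespace Problem

variable {P : Problem n} {α p : ℝ} {x v₀ v₁ d : Eucl n}

/-- Convexity of the linearized penalty function, whose value at `x` is the penalty function itself.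
-/
lemma linearized_add_smul_le {t : ℝ} (ht0 : 0 ≤ t) (ht1 : t ≤ 1) :
    P.linearized p x v₀ v₁ (x + t • d) ≤
      (1 - t) * P.penalized p x + t * P.linearized p x v₀ v₁ (x + d) := by
  simp only [linearized, penalized, add_sub_cancel_left, inner_smul_right]
  have h1 : max (P.φ₁ x + t * ⟪gradient P.g₁ x - v₁, d⟫_ℝ) 0 ≤
      (1 - t) * max (P.φ₁ x) 0 + t * max (P.φ₁ x + ⟪gradient P.g₁ x - v₁, d⟫_ℝ) 0 := by
    have a1 := mul_le_mul_of_nonneg_left (le_max_left (P.φ₁ x) 0) (sub_nonneg.2 ht1)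
    have a2 := mul_le_mul_of_nonneg_left
      (le_max_left (P.φ₁ x + ⟪gradient P.g₁ x - v₁, d⟫_ℝ) 0) ht0
    refine max_le (by linarith) ?_
    have := sub_nonneg.2 ht1
    positivity
  linarith

/-- The solution of the subproblem decreases the linearized penalty function. -/
lemma SolvesSubproblem.linearized_le (hd : P.SolvesSubproblem α p x v₀ v₁ d)
    (hX : Convex ℝ P.X) (hx : x ∈ P.X) :
    P.linearized p x v₀ v₁ (x + d) + α * ‖d‖ ^ 2 ≤ P.penalized p x := by
  -- Comparing `d` with `t • d` and cancelling `1 - t` gives this; `t → 1` yields the full `α`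
  -- instead of `α / 2`.
  have key : ∀ t ∈ Set.Ico (0 : ℝ) 1,
      P.linearized p x v₀ v₁ (x + d) + α / 2 * (1 + t) * ‖d‖ ^ 2 ≤ P.penalized p x := by
    intro t ht
    have hmem : x + t • d ∈ P.X := hX.add_smul_mem hx hd.1 ⟨ht.1, ht.2.le⟩
    have h1 := hd.2 hmem
    simp only [Set.mem_ofPred_eq, norm_smul, Real.norm_eq_abs, abs_of_nonneg ht.1, mul_pow] at h1
    have h2 := linearized_add_smul_le (P := P) (p := p) (x := x) (v₀ := v₀) (v₁ := v₁) (d := d) ht.1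
      ht.2.le
    have h3 : 0 < 1 - t := sub_pos.2 ht.2
    refine le_of_mul_le_mul_left ?_ h3
    linarith
  have hlim : Tendsto (fun t : ℝ => P.linearized p x v₀ v₁ (x + d) + α / 2 * (1 + t) * ‖d‖ ^ 2)
      (𝓝[<] 1) (𝓝 (P.linearized p x v₀ v₁ (x + d) + α / 2 * (1 + 1) * ‖d‖ ^ 2)) := by
    have : Continuous fun t : ℝ =>
      P.linearized p x v₀ v₁ (x + d) + α / 2 * (1 + t) * ‖d‖ ^ 2 := by fun_prop
    exact (this.tendsto 1).mono_left nhdsWithin_le_nhds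
  have := le_of_tendsto hlim (by
    filter_upwards [Ico_mem_nhdsLT (zero_lt_one' ℝ)] with t ht using key t ht)
  linarith

/-- Cauchy–Schwarz limits the linear decrease, which must pay for `α * ‖d‖ ^ 2`. -/
lemma SolvesSubproblem.norm_le (hd : P.SolvesSubproblem α p x v₀ v₁ d) (hp : 0 < p)
    (hX : Convex ℝ P.X) (hx : x ∈ P.X) :
    α * ‖d‖ ≤ 1 / p * ‖gradient P.g₀ x - v₀‖ + ‖gradient P.g₁ x - v₁‖ := by
  rcases eq_or_ne d 0 with rfl | hd0
  · rw [norm_zero, mul_zero]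
    positivity
  have hdpos : 0 < ‖d‖ := norm_pos_iff.2 hd0
  have h1 := hd.linearized_le hX hx
  simp only [linearized, penalized, add_sub_cancel_left] at h1
  have a0 := neg_le_of_abs_le (abs_real_inner_le_norm (gradient P.g₀ x - v₀) d)
  have a1 := neg_le_of_abs_le (abs_real_inner_le_norm (gradient P.g₁ x - v₁) d)
  have a2 := mul_le_mul_of_nonneg_left a0 (one_div_nonneg.2 hp.le)
  have a3 : max (P.φ₁ x) 0 - ‖gradient P.g₁ x - v₁‖ * ‖d‖ ≤
      max (P.φ₁ x + ⟪gradient P.g₁ x - v₁, d⟫_ℝ) 0 := by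
    rw [sub_le_iff_le_add]
    have b1 := le_max_left (P.φ₁ x + ⟪gradient P.g₁ x - v₁, d⟫_ℝ) 0
    refine max_le (by linarith) ?_
    have b2 := le_max_right (P.φ₁ x + ⟪gradient P.g₁ x - v₁, d⟫_ℝ) 0
    positivity
  refine le_of_mul_le_mul_right ?_ hdpos
  linarith

/-- The variational inequality satisfied by a solution of the subproblem at which the linearized
constraint is violated. -/
lemma SolvesSubproblem.variational (hd : P.SolvesSubproblem α p x v₀ v₁ d)
    (hX : Convex ℝ P.X) (hpos : 0 < P.φ₁ x + ⟪gradient P.g₁ x - v₁, d⟫_ℝ)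
    {y : Eucl n} (hy : y ∈ P.X) :
    0 ≤ 1 / p * ⟪gradient P.g₀ x - v₀, y - (x + d)⟫_ℝ +
      ⟪gradient P.g₁ x - v₁, y - (x + d)⟫_ℝ + α * ⟪d, y - (x + d)⟫_ℝ := by
  set w := y - (x + d) with hw
  have hlin : Tendsto (fun t : ℝ => P.φ₁ x + ⟪gradient P.g₁ x - v₁, d⟫_ℝ +
      t * ⟪gradient P.g₁ x - v₁, w⟫_ℝ) (𝓝[>] 0)
      (𝓝 (P.φ₁ x + ⟪gradient P.g₁ x - v₁, d⟫_ℝ + 0 * ⟪gradient P.g₁ x - v₁, w⟫_ℝ)) := by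
    have : Continuous fun t : ℝ => P.φ₁ x + ⟪gradient P.g₁ x - v₁, d⟫_ℝ +
      t * ⟪gradient P.g₁ x - v₁, w⟫_ℝ := by fun_prop
    exact (this.tendsto 0).mono_left nhdsWithin_le_nhds
  have hlim : Tendsto (fun t : ℝ => 1 / p * ⟪gradient P.g₀ x - v₀, w⟫_ℝ +
      ⟪gradient P.g₁ x - v₁, w⟫_ℝ + α * ⟪d, w⟫_ℝ + α / 2 * t * ‖w‖ ^ 2) (𝓝[>] 0)
      (𝓝 (1 / p * ⟪gradient P.g₀ x - v₀, w⟫_ℝ +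
      ⟪gradient P.g₁ x - v₁, w⟫_ℝ + α * ⟪d, w⟫_ℝ + α / 2 * 0 * ‖w‖ ^ 2)) := by
    have : Continuous fun t : ℝ => 1 / p * ⟪gradient P.g₀ x - v₀, w⟫_ℝ +
      ⟪gradient P.g₁ x - v₁, w⟫_ℝ + α * ⟪d, w⟫_ℝ + α / 2 * t * ‖w‖ ^ 2 := by fun_prop
    exact (this.tendsto 0).mono_left nhdsWithin_le_nhds
  -- For small `t` the linearized constraint stays positive at `d + t • w`, so both maxima equal
  -- their first argument; minimality is then divided by `t`.
  have := ge_of_tendsto hlim (b := 0) (by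
    filter_upwards [Ioc_mem_nhdsGT (zero_lt_one' ℝ),
      hlin.eventually_const_lt (by simpa using hpos)] with t ht htpos
    have hmem : x + (d + t • w) ∈ P.X := by
      have := hX.add_smul_sub_mem hd.1 hy ⟨ht.1.le, ht.2⟩
      rwa [add_assoc] at this
    have h1 := hd.2 hmem
    simp only [Set.mem_ofPred_eq, linearized, add_sub_cancel_left, inner_add_right,
      inner_smul_right, ← add_assoc] at h1
    rw [max_eq_left hpos.le, max_eq_left htpos.le, norm_add_sq_real, norm_smul, mul_pow,
      inner_smul_right, Real.norm_eq_abs, sq_abs] at h1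
    refine le_of_mul_le_mul_left ?_ ht.1
    linarith)
  linarith

end Problem

namespace Problem

variable {P : Problem n}

/-- Quadratic upper models of `φ₀` and `φ₁` combine to one of the penalty function along a step
towards the solution of the subproblem. -/
lemma SolvesSubproblem.penalized_le {α p : ℝ} {x v₀ v₁ d : Eucl n}
    (hd : P.SolvesSubproblem α p x v₀ v₁ d) (hp : 0 < p) (hX : Convex ℝ P.X) (hx : x ∈ P.X)
    {s C₀ C₁ : ℝ} (hs0 : 0 ≤ s) (hs1 : s ≤ 1) (hC₁ : 0 ≤ C₁)
    (h₀ : P.φ₀ (x + s • d) ≤ P.φ₀ x + s * ⟪gradient P.g₀ x - v₀, d⟫_ℝ + C₀ * (s * ‖d‖) ^ 2)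
    (h₁ : P.φ₁ (x + s • d) ≤ P.φ₁ x + s * ⟪gradient P.g₁ x - v₁, d⟫_ℝ + C₁ * (s * ‖d‖) ^ 2) :
    P.penalized p (x + s • d) ≤
      P.penalized p x - s * (α * ‖d‖ ^ 2) + (C₀ / p + C₁) * (s * ‖d‖) ^ 2 := by
  have a1 := mul_le_mul_of_nonneg_left h₀ (one_div_nonneg.2 hp.le)
  have a2 : max (P.φ₁ (x + s • d)) 0 ≤
      max (P.φ₁ x + s * ⟪gradient P.g₁ x - v₁, d⟫_ℝ) 0 + C₁ * (s * ‖d‖) ^ 2 := by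
    have b := le_max_left (P.φ₁ x + s * ⟪gradient P.g₁ x - v₁, d⟫_ℝ) 0
    have b' := le_max_right (P.φ₁ x + s * ⟪gradient P.g₁ x - v₁, d⟫_ℝ) 0
    exact max_le (by linarith) (by positivity)
  have a3 := linearized_add_smul_le (P := P) (p := p) (x := x) (v₀ := v₀) (v₁ := v₁) (d := d)
    hs0 hs1
  have a4 := mul_le_mul_of_nonneg_left (hd.linearized_le hX hx) hs0
  have a5 : P.linearized p x v₀ v₁ (x + s • d) =
      1 / p * (P.φ₀ x + s * ⟪gradient P.g₀ x - v₀, d⟫_ℝ) +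
        max (P.φ₁ x + s * ⟪gradient P.g₁ x - v₁, d⟫_ℝ) 0 := by
    simp only [linearized, add_sub_cancel_left, inner_smul_right]
  have a6 : P.penalized p (x + s • d) =
    1 / p * P.φ₀ (x + s • d) + max (P.φ₁ (x + s • d)) 0 := rfl
  rw [div_eq_mul_one_div]
  linarith

end Problem

/-! ### Asymptotics of the generated sequences -/

namespace Trace.Generated

variable {P : Problem n} {A : Params} {T : Trace n}

lemma step_mem_Ioc (hA : A.Admissible) (q : ℕ) : A.β ^ q ∈ Set.Ioc (0 : ℝ) 1 :=
  ⟨pow_pos hA.β_pos _, pow_le_one₀ hA.β_pos.le hA.β_lt_one.le⟩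

lemma x_mem (hT : T.Generated P A) (hP : P.Standing) (hA : A.Admissible) (k : ℕ) :
    T.x k ∈ P.X := by
  induction k with
  | zero => exact hT.x_zero
  | succ k ih =>
    rw [hT.x_succ]
    have := step_mem_Ioc hA (T.q k)
    exact hP.convex.add_smul_mem ih (hT.d_solves k).1 ⟨this.1.le, this.2⟩

lemma p_monotone (hT : T.Generated P A) (hA : A.Admissible) : Monotone T.p := by
  refine monotone_nat_of_le_succ fun k => ?_
  rw [hT.p_succ]
  split_ifs
  · linarith [hA.ρ_pos]
  · exact le_rfl

lemma p₀_le (hT : T.Generated P A) (hA : A.Admissible) (k : ℕ) : A.p₀ ≤ T.p k :=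
  hT.p_zero ▸ hT.p_monotone hA (Nat.zero_le k)

lemma p_pos (hT : T.Generated P A) (hA : A.Admissible) (k : ℕ) : 0 < T.p k :=
  hA.p₀_pos.trans_le (hT.p₀_le hA k)

lemma tendsto_p (hT : T.Generated P A) (hA : A.Admissible)
    (hunb : ¬ Bornology.IsBounded (Set.range T.p)) : Tendsto T.p atTop atTop := by
  refine tendsto_atTop_atTop_of_monotone' (hT.p_monotone hA) fun hbdd => hunb ?_
  refine isBounded_iff_bddBelow_bddAbove.2 ⟨⟨A.p₀, ?_⟩, hbdd⟩
  rintro _ ⟨k, rfl⟩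
  exact hT.p₀_le hA k

lemma frequently_violation (hT : T.Generated P A)
    (hp : Tendsto T.p atTop atTop) :
    ∃ᶠ k in atTop, A.c * ‖T.d k‖ ≤ P.violation (T.x k) (T.v₁ k) (T.d k) := by
  intro hnot
  obtain ⟨N, hN⟩ := eventually_atTop.1 hnot
  have hconst : ∀ k ≥ N, T.p k = T.p N := by
    intro k hk
    induction k, hk using Nat.le_induction with
    | base => rfl
    | succ k hk ih => rw [hT.p_succ, if_neg (hN k hk), ih]
  obtain ⟨k, hk, hk'⟩ := ((hp.eventually_gt_atTop (T.p N)).and (eventually_ge_atTop N)).exists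
  exact hk.ne' (hconst k hk')

/-- The decrease achieved by the steps tends to zero. -/
lemma tendsto_step_mul_sq (hT : T.Generated P A) (hP : P.Standing) (hA : A.Admissible) :
    Tendsto (fun k => A.β ^ T.q k * ‖T.d k‖ ^ 2) atTop (𝓝 0) := by
  obtain ⟨m, hm⟩ := hP.φ₀_bddBelow
  have hmx : ∀ k, m ≤ P.φ₀ (T.x k) := fun k =>
    hm (Set.mem_image_of_mem _ (hT.x_mem hP hA k))
  -- Shifting `φ₀` by its lower bound makes its weighted term nonnegative, so raising `p` cannot
  -- increase `E`.
  set E : ℕ → ℝ := fun k => P.penalized (T.p k) (T.x k) - 1 / T.p k * m with hE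
  have hE' : ∀ k, E k = 1 / T.p k * (P.φ₀ (T.x k) - m) + max (P.φ₁ (T.x k)) 0 := fun k => by
    simp only [hE, Problem.penalized]; ring
  have hE0 : ∀ k, 0 ≤ E k := fun k => by
    rw [hE']
    have := sub_nonneg.2 (hmx k)
    have := hT.p_pos hA k
    positivity
  have hdec : ∀ k, E (k + 1) ≤ E k - A.σ * A.α * (A.β ^ T.q k * ‖T.d k‖ ^ 2) := by
    intro k
    have h1 : P.penalized (T.p k) (T.x k + A.β ^ T.q k • T.d k) ≤
      P.penalized (T.p k) (T.x k) - A.σ * A.β ^ T.q k * A.α * ‖T.d k‖ ^ 2 := (hT.linesearch k).1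
    rw [← hT.x_succ] at h1
    have h2 : 1 / T.p (k + 1) ≤ 1 / T.p k :=
      one_div_le_one_div_of_le (hT.p_pos hA k) (hT.p_monotone hA k.le_succ)
    have h3 := mul_le_mul_of_nonneg_right h2 (sub_nonneg.2 (hmx (k + 1)))
    rw [hE' (k + 1)]
    simp only [Problem.penalized] at h1
    simp only [hE, Problem.penalized]
    linarith
  have hσα : 0 < A.σ * A.α := mul_pos hA.σ_pos hA.α_pos
  have hnn : ∀ k, 0 ≤ A.β ^ T.q k * ‖T.d k‖ ^ 2 := fun k =>
    mul_nonneg (step_mem_Ioc hA _).1.le (sq_nonneg _)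
  have hanti : Antitone E := antitone_nat_of_succ_le fun k => by
    have := mul_nonneg hσα.le (hnn k)
    linarith [hdec k]
  have hlim := tendsto_atTop_ciInf hanti ⟨0, by rintro _ ⟨k, rfl⟩; exact hE0 k⟩
  have hdiff : Tendsto (fun k => (E k - E (k + 1)) / (A.σ * A.α)) atTop (𝓝 0) := by
    simpa using (hlim.sub (hlim.comp (tendsto_add_atTop_nat 1))).div_const (A.σ * A.α)
  refine squeeze_zero hnn (fun k => ?_) hdiff
  rw [le_div_iff₀ hσα]
  linarith [hdec k]

/-- Directions converge to zero along every filter along which iterates, subgradients and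
directions converge. -/
lemma limit_direction_eq_zero (hT : T.Generated P A) (hP : P.Standing) (hA : A.Admissible)
    {l : Filter ℕ} [l.NeBot] (hl : l ≤ atTop) {x v₀ v₁ d : Eucl n} (hx : Tendsto T.x l (𝓝 x))
    (hv₀ : Tendsto T.v₀ l (𝓝 v₀)) (hv₁ : Tendsto T.v₁ l (𝓝 v₁)) (hd : Tendsto T.d l (𝓝 d)) :
    d = 0 := by
  by_contra hd0
  have hdpos : 0 < ‖d‖ := norm_pos_iff.2 hd0
  have hxX : x ∈ P.X :=
    hP.closed.mem_of_tendsto hx (Eventually.of_forall (hT.x_mem hP hA))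
  have hτ : Tendsto (fun k => A.β ^ T.q k) l (𝓝 0) := by
    have h1 := ((hT.tendsto_step_mul_sq hP hA).mono_left hl).div (hd.norm.pow 2)
      (pow_pos hdpos 2).ne'
    rw [zero_div] at h1
    refine h1.congr' ?_
    filter_upwards [hd.norm.eventually_const_lt hdpos] with k hk
    exact mul_div_cancel_right₀ _ (pow_pos hk 2).ne'
  -- The last rejected trial step, as soon as `T.q k` is positive.
  set s : ℕ → ℝ := fun k => A.β ^ T.q k / A.β with hs
  have hs0 : Tendsto s l (𝓝 0) := by simpa using hτ.div_const A.β
  have hmem₀ := (hP.h₀_lip x hxX).mem_limitingSubdiff_of_tendsto hx hv₀ hT.v₀_mem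
  have hmem₁ := (hP.h₁_lip x hxX).mem_limitingSubdiff_of_tendsto hx hv₁ hT.v₁_mem
  obtain ⟨C₀, hC₀, δ₀, hδ₀, hm₀⟩ := exists_upper_model_sub hP.g₀_c11 hP.convex hxX
    (hP.h₀_prox x hxX) (hP.h₀_lip x hxX) hmem₀
  obtain ⟨C₁, hC₁, δ₁, hδ₁, hm₁⟩ := exists_upper_model_sub hP.g₁_c11 hP.convex hxX
    (hP.h₁_prox x hxX) (hP.h₁_lip x hxX) hmem₁
  have hx' : Tendsto (fun k => T.x k + s k • T.d k) l (𝓝 x) := by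
    simpa using hx.add (hs0.smul hd)
  -- Since `T.p k ≥ A.p₀`, this bounds the quadratic error coefficient for every `k`.
  have hbig : Tendsto (fun k => (C₀ / A.p₀ + C₁) * s k) l (𝓝 0) := by
    simpa using hs0.const_mul (C₀ / A.p₀ + C₁)
  have hσ : 0 < (1 - A.σ) * A.α := mul_pos (sub_pos.2 hA.σ_lt_one) hA.α_pos
  have ball : ∀ {y : ℕ → Eucl n} {z : Eucl n} {δ : ℝ}, 0 < δ → Tendsto y l (𝓝 z) →
      ∀ᶠ k in l, y k ∈ Metric.ball z δ := fun hδ hy => hy.eventually_mem (Metric.ball_mem_nhds _ hδ)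
  obtain ⟨k, hk⟩ := ((hτ.eventually_lt_const one_pos).and <| (hbig.eventually_lt_const hσ).and <|
    (hd.norm.eventually_const_lt hdpos).and <| (ball hδ₀ hx).and <| (ball hδ₁ hx).and <|
    (ball hδ₀ hx').and <| (ball hδ₁ hx').and <| (ball hδ₀ hv₀).and (ball hδ₁ hv₁)).exists
  obtain ⟨kτ, kbig, kd, kx₀, kx₁, ky₀, ky₁, kv₀, kv₁⟩ := hk
  obtain ⟨j, hj⟩ : ∃ j, T.q k = j + 1 := by
    refine Nat.exists_eq_succ_of_ne_zero fun h => ?_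
    simp [h] at kτ
  have hsk : s k = A.β ^ j := by
    simp only [hs, hj, pow_succ]
    exact mul_div_cancel_right₀ _ hA.β_pos.ne'
  have hsI := step_mem_Ioc hA j
  rw [← hsk] at hsI
  have hfail : ¬ P.SufficientDecrease A.σ A.α (T.p k) (T.x k) (T.d k) (s k) := by
    intro h
    rw [hsk] at h
    have := (hT.linesearch k).2 h
    omega
  have hxk := hT.x_mem hP hA k
  have hyk : T.x k + s k • T.d k ∈ P.X :=
    hP.convex.add_smul_mem hxk (hT.d_solves k).1 ⟨hsI.1.le, hsI.2⟩
  have e₀ := hm₀ _ ⟨hxk, kx₀⟩ _ ⟨hyk, ky₀⟩ _ (hT.v₀_mem k) kv₀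
  have e₁ := hm₁ _ ⟨hxk, kx₁⟩ _ ⟨hyk, ky₁⟩ _ (hT.v₁_mem k) kv₁
  simp only [add_sub_cancel_left, inner_smul_right, norm_smul, Real.norm_eq_abs,
    abs_of_pos hsI.1] at e₀ e₁
  have hpen := (hT.d_solves k).penalized_le (hT.p_pos hA k) hP.convex hxk hsI.1.le hsI.2 hC₁ e₀ e₁
  refine hfail (hpen.trans ?_)
  have hCp : C₀ / T.p k ≤ C₀ / A.p₀ := div_le_div_of_nonneg_left hC₀ hA.p₀_pos (hT.p₀_le hA k)
  have h1 : (C₀ / T.p k + C₁) * s k ≤ (1 - A.σ) * A.α :=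
    (mul_le_mul_of_nonneg_right (by linarith) hsI.1.le).trans kbig.le
  have h2 := mul_le_mul_of_nonneg_right h1 (mul_nonneg hsI.1.le (sq_nonneg ‖T.d k‖))
  linarith

end Trace.Generated

end CDP

/-! ### Boundedness of the penalty parameters -/

theorem mainTheorem6 (n : ℕ) (P : CDP.Problem n) (hP : P.Standing)
    (A : CDP.Params) (hA : A.Admissible)
    (T : CDP.Trace n) (hT : T.Generated P A)
    (hterm : ∀ k, ¬ T.StopsAt P k)
    (hbdd : Bornology.IsBounded (Set.range T.x))
    (hcq : ∀ z : CDP.Eucl n, MapClusterPt z Filter.atTop T.x → P.ENNAMCQ z) :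
    Bornology.IsBounded (Set.range T.p) := by
  by_contra hunb
  have hp := hT.tendsto_p hA hunb
  -- An ultrafilter replaces successive extraction of subsequences.
  obtain ⟨U, hU, hUviol⟩ : ∃ U : Ultrafilter ℕ, (U : Filter ℕ) ≤ atTop ∧
      ∀ᶠ k in (U : Filter ℕ), A.c * ‖T.d k‖ ≤ P.violation (T.x k) (T.v₁ k) (T.d k) := by
    have := frequently_iff_neBot.1 (hT.frequently_violation hp)
    have hle := Ultrafilter.of_le (atTop ⊓
      𝓟 {k | A.c * ‖T.d k‖ ≤ P.violation (T.x k) (T.v₁ k) (T.d k)})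
    exact ⟨_, hle.trans inf_le_left, le_principal_iff.1 (hle.trans inf_le_right)⟩
  have hconv : ∀ {y : ℕ → CDP.Eucl n} {R : ℝ}, (∀ᶠ k in (U : Filter ℕ), ‖y k‖ ≤ R) →
      ∃ z, Tendsto y U (𝓝 z) := by
    intro y R hR
    have hmem : Metric.closedBall (0 : CDP.Eucl n) R ∈ U.map y :=
      hR.mono fun k hk => by simpa using hk
    obtain ⟨z, -, hz⟩ := (isCompact_closedBall (0 : CDP.Eucl n) R).ultrafilter_le_nhds' _ hmem
    exact ⟨z, hz⟩
  obtain ⟨R, hR⟩ := hbdd.exists_norm_le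
  obtain ⟨x, hx⟩ := hconv (Eventually.of_forall fun k => hR _ (Set.mem_range_self k))
  have hxT := hT.x_mem hP hA
  have hxX : x ∈ P.X := hP.closed.mem_of_tendsto hx (Eventually.of_forall hxT)
  have hlip₀ := hP.h₀_lip x hxX
  have hlip₁ := hP.h₁_lip x hxX
  obtain ⟨K₀, hK₀⟩ := hlip₀.exists_norm_le
  obtain ⟨K₁, hK₁⟩ := hlip₁.exists_norm_le
  obtain ⟨v₀, hv₀⟩ := hconv ((hx.eventually hK₀).mono fun k hk => hk _ (hT.v₀_mem k))
  obtain ⟨v₁, hv₁⟩ := hconv ((hx.eventually hK₁).mono fun k hk => hk _ (hT.v₁_mem k))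
  have hxw : Tendsto T.x U (𝓝[P.X] x) :=
    tendsto_nhdsWithin_iff.2 ⟨hx, Eventually.of_forall hxT⟩
  have ha₀ := ((hP.g₀_c11.2.continuousOn x hxX).tendsto.comp hxw).sub hv₀
  have ha₁ := ((hP.g₁_c11.2.continuousOn x hxX).tendsto.comp hxw).sub hv₁
  have hpinv : Tendsto (fun k => 1 / T.p k) U (𝓝 0) := by
    simpa [Function.comp_def] using (tendsto_inv_atTop_zero.comp hp).mono_left hU
  obtain ⟨d, hd⟩ : ∃ d, Tendsto T.d U (𝓝 d) := by
    have hb := ((hpinv.mul ha₀.norm).add ha₁.norm).div_const A.α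
    refine hconv ((hb.eventually_le_const (lt_add_one _)).mono fun k hk => le_trans ?_ hk)
    rw [le_div_iff₀' hA.α_pos]
    exact (hT.d_solves k).norm_le (hT.p_pos hA k) hP.convex (hxT k)
  obtain rfl := hT.limit_direction_eq_zero hP hA hU hx hv₀ hv₁ hd
  have hpos : ∀ᶠ k in (U : Filter ℕ),
      0 < P.φ₁ (T.x k) + ⟪gradient P.g₁ (T.x k) - T.v₁ k, T.d k⟫_ℝ := by
    -- When `T.d k = 0` the violation test says nothing; positivity then comes from nontermination.
    filter_upwards [hUviol] with k hk
    rcases eq_or_ne (T.d k) 0 with h0 | h0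
    · rw [h0, inner_zero_right, add_zero]
      exact lt_of_not_ge fun h => hterm k ⟨h0, h⟩
    · have h1 : 0 < A.c * ‖T.d k‖ := mul_pos hA.c_pos (norm_pos_iff.2 h0)
      exact (lt_max_iff.1 (h1.trans_le hk)).resolve_right (lt_irrefl 0)
  have hφ : Tendsto (fun k => P.φ₁ (T.x k)) U (𝓝 (P.φ₁ x)) :=
    ((hP.g₁_c11.1 x hxX).continuousAt.sub hlip₁.continuousAt_toReal).tendsto.comp hx
  have hφ0 : 0 ≤ P.φ₁ x := by
    have h1 := hφ.add (ha₁.inner (𝕜 := ℝ) hd)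
    rw [inner_zero_right, add_zero] at h1
    exact ge_of_tendsto h1 (hpos.mono fun k hk => hk.le)
  obtain ⟨-, hcq | ⟨-, hcq⟩⟩ := hcq x (hx.mapClusterPt.mono hU)
  · exact hcq.not_ge hφ0
  -- The normal vector cancelling `gradient P.g₁ x - v₁` is its negative, by the limiting
  -- variational inequality.
  refine hcq ⟨gradient P.g₁ x - v₁, ⟨_, rfl, v₁,
    hlip₁.mem_limitingSubdiff_of_tendsto hx hv₁ hT.v₁_mem, rfl⟩, -(gradient P.g₁ x - v₁),
    ⟨hxX, fun y hy => ?_⟩, add_neg_cancel _⟩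
  have hw : Tendsto (fun k => y - (T.x k + T.d k)) U (𝓝 (y - (x + 0))) :=
    tendsto_const_nhds.sub (hx.add hd)
  have hvi := ((hpinv.mul (ha₀.inner (𝕜 := ℝ) hw)).add (ha₁.inner (𝕜 := ℝ) hw)).add
    ((hd.inner (𝕜 := ℝ) hw).const_mul A.α)
  have := ge_of_tendsto hvi
    (hpos.mono fun k hk => (hT.d_solves k).variational hP.convex hk hy)
  simp only [zero_mul, zero_add, inner_zero_left, mul_zero, add_zero] at this
  rw [inner_neg_left]
  linarith
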